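/- There is an absolute constant $C>0$ such that the following holds. Let $n\ge 1$ and let $G_1,G_2$ be simple undirected graphs on the node set $[n]=\{1,\dots,n\}$ with nonnegative symmetric edge weights $w_1,w_2$ (weight $0$ meaning no edge) and Laplacians $M$ and $L$, respectively (each of the form $D-A$, with $D$ the diagonal matrix of weighted degrees and $A$ the weighted adjacency matrix). For disjoint $S,T\subseteq[n]$ let $\mathrm{cut}_{G_k}(S,T)=\sum_{i\in S,\,j\in T}w_k(i,j)$, write $\lambda_1(X)\le\dots\le\lambda_n(X)$ for the eigenvalues of a symmetric matrix $X$, and $\|X\|$ for its Euclidean operator norm. Let $\eta,\gamma,\epsilon>0$ and suppose that 1. for all $i\in[n]$, $\sum_{j\ne i}|w_1(i,j)-w_2(i,j)|\le\eta$; 2. for all $i\in[n]$, the weighted degrees of $i$ in $G_1$ and in $G_2$ differ by at most $\gamma$ in absolute value; 3. for all disjoint $S,T\subseteq[n]$, $|\mathrm{cut}_{G_1}(S,T)-\mathrm{cut}_{G_2}(S,T)|\le\epsilon\sqrt{|S||T|}$. Then $$\|M-L\|\le C\bigl(\epsilon\max\{1,\ln(\eta/\epsilon)\}+\gamma\bigr),$$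 and, if every node has the same weighted degree in $G_1$ as in $G_2$, then $\|M-L\|\le C\,\epsilon\max\{1,\ln(\eta/\epsilon)\}$. (When $\eta\ge e\,\epsilon$, the maximum is $\ln(\eta/\epsilon)$.) Moreover, for every real $\Delta\ge\|M-L\|$, $$\max_{i\in[n]}\frac{\lambda_i(M)-2\Delta}{(1+\lambda_i(M)+\Delta)^2}\;\le\;\lambda_n\bigl((I+L)^{-1}M(I+L)^{-1}\bigr)\;\le\;\max_{i\in[n]}\frac{\lambda_i(M)+2\Delta}{(1+\max\{\lambda_i(M)-\Delta,0\})^2},$$ and, if $\Delta<1$, also $$\lambda_n\bigl((I+L)^{-1}M(I+L)^{-1}\bigr)\;\le\;\max_{i\in[n]}\frac{\lambda_i(M)+2\Delta}{(1+\lambda_i(M)-\Delta)^2}.$$ -/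

import Mathlib

noncomputable section

namespace MixedGraph

/-- A simple, undirected, weighted graph on the nodes `Fin n`, presented as a complete graph with
nonnegative weights; `w i j = 0` means that `i` and `j` are not adjacent. -/
structure WGraph (n : ℕ) where
  w : Fin n → Fin n → ℝ
  nonneg : ∀ i j, 0 ≤ w i j
  symm : ∀ i j, w i j = w j i
  loopless : ∀ i, w i i = 0

namespace WGraph

variable {n : ℕ}

/-- The weighted degree of a node. -/
def deg (G : WGraph n) (i : Fin n) : ℝ := ∑ j, G.w i j

/-- The Laplacian `D - A`. -/
def lap (G : WGraph n) : Matrix (Fin n) (Fin n) ℝ :=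
  Matrix.diagonal G.deg - Matrix.of G.w

/-- The total weight between `S` and `T` (used for disjoint `S` and `T`). -/
def cut (G : WGraph n) (S T : Finset (Fin n)) : ℝ := ∑ i ∈ S, ∑ j ∈ T, G.w i j

theorem lap_isHermitian (G : WGraph n) : G.lap.IsHermitian := by
  refine (Matrix.isHermitian_diagonal _).sub ?_
  ext i j
  simpa using G.symm j i

end WGraph

/-- The operator norm of a real square matrix with respect to the Euclidean norm. -/
def opNorm {n : ℕ} (A : Matrix (Fin n) (Fin n) ℝ) : ℝ :=
  ‖Matrix.toEuclideanCLM (n := Fin n) (𝕜 := ℝ) A‖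

/-- The eigenvalues of a symmetric matrix, with multiplicity, in increasing order: for
`i : Fin n`, this is the `(i + 1)`-st smallest one. (`eigenvalues₀` lists them in decreasing
order.) -/
def eig {n : ℕ} {A : Matrix (Fin n) (Fin n) ℝ} (hA : A.IsHermitian) (i : Fin n) : ℝ :=
  hA.eigenvalues₀ (Fin.cast (Fintype.card_fin n).symm i.rev)

/-- The matrix `(I + L)⁻¹ M (I + L)⁻¹` of the mixed-graph objective, where `M` is the Laplacian
of `G₁` and `L` is the Laplacian of `G₂`. -/
def mixed {n : ℕ} (G₁ G₂ : WGraph n) : Matrix (Fin n) (Fin n) ℝ :=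
  (1 + G₂.lap)⁻¹ * G₁.lap * (1 + G₂.lap)⁻¹

theorem mixed_isHermitian {n : ℕ} (G₁ G₂ : WGraph n) : (mixed G₁ G₂).IsHermitian := by
  have h : ((1 + G₂.lap)⁻¹).IsHermitian := (Matrix.isHermitian_one.add G₂.lap_isHermitian).inv
  unfold mixed Matrix.IsHermitian
  rw [Matrix.conjTranspose_mul, Matrix.conjTranspose_mul, h.eq, G₁.lap_isHermitian.eq,
    Matrix.mul_assoc]

/-- The largest eigenvalue `λ_n` of the mixed-graph objective matrix. -/
def mixedTop {n : ℕ} [NeZero n] (G₁ G₂ : WGraph n) : ℝ :=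
  eig (mixed_isHermitian G₁ G₂) ⊤

/-- The maximum of finitely many reals indexed by the nodes. -/
def maxOver {n : ℕ} [NeZero n] (f : Fin n → ℝ) : ℝ :=
  Finset.univ.sup' Finset.univ_nonempty f

end MixedGraph

end

/-! The norm bound is the Bilu–Linial converse of the expander mixing lemma, applied to the
difference `a` of the weight matrices. Passing to arbitrary pairs of sets costs a factor 4 in the
cut bound (`abs_sum_sum_le_four_mul`). Binary digits turn the bilinear form of integer vectors into
a sum of `2 ^ k * 2 ^ l` times cut values. Levels with `|k - l| ≤ K`, where `2 ^ K` is about `η /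
ε`, are controlled by discrepancy; for the others the row sum bound `η` gives geometric decay. Each
level thus interacts with about `K` others, which is the logarithm (`two_pow_mul_abs_le`,
`abs_dyadic_sum_le`). Scaling and positive and negative parts reach real vectors, and the degree
differences add a diagonal matrix of norm at most `γ`.

For the eigenvalue bounds, `M` and `L` differ by at most `Δ` as quadratic forms, so by Weyl's
inequality their ordered eigenvalues do too. The top mixed eigenvalue is the least `B` with `M ≤ B
(1 + L)²`. Eigenvectors of `L` bound it from below; diagonalizing `L + Δ ≤ B (1 + L)²` bounds it
from above. -/

namespace MixedGraph

open scoped RealInnerProductSpace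

/-! ### Quadratic forms in an orthonormal eigenbasis -/

section Spectral

variable {E : Type*} [NormedAddCommGroup E] [InnerProductSpace ℝ E] {n : ℕ}

theorem inner_map_self_eq_sum {b : OrthonormalBasis (Fin n) ℝ E} {T : E →L[ℝ] E} {μ : Fin n → ℝ}
    (hT : ∀ i, T (b i) = μ i • b i) (x : E) : ⟪x, T x⟫ = ∑ i, μ i * ⟪b i, x⟫ ^ 2 := by
  conv_lhs => rw [← b.sum_repr' x]
  simp only [map_sum, map_smul, hT]
  rw [b.sum_repr' x, inner_sum]
  refine Finset.sum_congr rfl fun i _ => ?_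
  rw [inner_smul_right, inner_smul_right, real_inner_comm]
  ring

theorem norm_sq_eq_sum_inner (b : OrthonormalBasis (Fin n) ℝ E) (x : E) :
    ‖x‖ ^ 2 = ∑ i, ⟪b i, x⟫ ^ 2 := by
  rw [← b.sum_sq_norm_inner_right x]
  simp

/-- **Weyl's inequality** for eigenvalues listed in increasing order. -/
theorem eigenvalue_le_add {b c : OrthonormalBasis (Fin n) ℝ E} {T S : E →L[ℝ] E}
    {μ ν : Fin n → ℝ} (hT : ∀ i, T (b i) = μ i • b i) (hS : ∀ i, S (c i) = ν i • c i)
    (hμ : Monotone μ) (hν : Monotone ν) {Δ : ℝ}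
    (h : ∀ x, ⟪x, T x⟫ ≤ ⟪x, S x⟫ + Δ * ‖x‖ ^ 2) (i : Fin n) : μ i ≤ ν i + Δ := by
  have : FiniteDimensional ℝ E := b.toBasis.finiteDimensional_of_finite
  -- These are `n - 1` linear conditions in dimension `n`, so some nonzero `x` is orthogonal to `b
  -- k` for `k < i` and to `c k` for `k > i`. On it the form of `T` is at least `μ i` and that of
  -- `S` at most `ν i`, per unit of `‖x‖ ^ 2`.
  let φ : E →ₗ[ℝ] ({k : Fin n // k ≠ i} → ℝ) :=
    LinearMap.pi fun k => (innerSL ℝ (if (k : Fin n) < i then b k else c k)).toLinearMap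
  have hker : LinearMap.ker φ ≠ ⊥ := by
    refine LinearMap.ker_ne_bot_of_finrank_lt ?_
    rw [Module.finrank_fintype_fun_eq_card, Module.finrank_eq_card_basis b.toBasis]
    exact Fintype.card_subtype_lt (x := i) (by simp)
  obtain ⟨x, hx, hx0⟩ := Submodule.exists_mem_ne_zero_of_ne_bot hker
  have hφ : ∀ k, k ≠ i → ⟪if k < i then b k else c k, x⟫ = 0 := fun k hk =>
    congrFun (LinearMap.mem_ker.1 hx) ⟨k, hk⟩
  have h1 : μ i * ‖x‖ ^ 2 ≤ ⟪x, T x⟫ := by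
    rw [inner_map_self_eq_sum hT, norm_sq_eq_sum_inner b, Finset.mul_sum]
    refine Finset.sum_le_sum fun k _ => ?_
    by_cases hk : k < i
    · have := hφ k hk.ne
      rw [if_pos hk] at this
      simp [this]
    · exact mul_le_mul_of_nonneg_right (hμ (not_lt.1 hk)) (sq_nonneg _)
  have h2 : ⟪x, S x⟫ ≤ ν i * ‖x‖ ^ 2 := by
    rw [inner_map_self_eq_sum hS, norm_sq_eq_sum_inner c, Finset.mul_sum]
    refine Finset.sum_le_sum fun k _ => ?_
    by_cases hk : i < k
    · have := hφ k hk.ne'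
      rw [if_neg hk.le.not_gt] at this
      simp [this]
    · exact mul_le_mul_of_nonneg_right (hν (not_lt.1 hk)) (sq_nonneg _)
  have h3 : 0 < ‖x‖ ^ 2 := by positivity
  have h4 := h x
  refine le_of_mul_le_mul_right ?_ h3
  linarith

theorem inner_map_self_le {b : OrthonormalBasis (Fin n) ℝ E} {T : E →L[ℝ] E} {μ : Fin n → ℝ}
    (hT : ∀ i, T (b i) = μ i • b i) {B : ℝ} (hB : ∀ i, μ i ≤ B) (x : E) :
    ⟪x, T x⟫ ≤ B * ‖x‖ ^ 2 := by
  rw [inner_map_self_eq_sum hT, norm_sq_eq_sum_inner b, Finset.mul_sum]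
  exact Finset.sum_le_sum fun k _ => mul_le_mul_of_nonneg_right (hB k) (sq_nonneg _)

theorem inner_eigenvector_map {b : OrthonormalBasis (Fin n) ℝ E} {T : E →L[ℝ] E} {μ : Fin n → ℝ}
    (hT : ∀ i, T (b i) = μ i • b i) (i : Fin n) : ⟪b i, T (b i)⟫ = μ i := by
  rw [hT, inner_smul_right]
  simp

/-- If `L ≥ 0` has eigenvalues `ν` and `M ≤ L + Δ`, then `M ≤ B (1 + L)²` as soon as
`ν + Δ ≤ B (1 + ν)²` for every eigenvalue. -/
theorem inner_map_self_le_of_resolvent {b : OrthonormalBasis (Fin n) ℝ E} {M L : E →L[ℝ] E}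
    {ν : Fin n → ℝ} (hL : ∀ i, L (b i) = ν i • b i) {Δ B : ℝ}
    (h : ∀ x, ⟪x, M x⟫ ≤ ⟪x, L x⟫ + Δ * ‖x‖ ^ 2)
    (hB : ∀ i, ν i + Δ ≤ B * (1 + ν i) ^ 2) (x : E) :
    ⟪x, M x⟫ ≤ B * ‖x + L x‖ ^ 2 := by
  have hi : ∀ i, ⟪b i, x + L x⟫ = (1 + ν i) * ⟪b i, x⟫ := fun i => by
    have : ⟪b i, L x⟫ = ν i * ⟪b i, x⟫ := by
      conv_lhs => rw [← b.sum_repr' x]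
      simp only [map_sum, map_smul, hL, inner_sum, inner_smul_right,
        orthonormal_iff_ite.1 b.orthonormal]
      simp [mul_comm]
    rw [inner_add_right, this]
    ring
  refine (h x).trans ?_
  rw [inner_map_self_eq_sum hL, norm_sq_eq_sum_inner b, norm_sq_eq_sum_inner b, Finset.mul_sum,
    Finset.mul_sum, ← Finset.sum_add_distrib]
  refine Finset.sum_le_sum fun i _ => ?_
  rw [hi, mul_pow, ← mul_assoc, ← add_mul]
  exact mul_le_mul_of_nonneg_right (hB i) (sq_nonneg _)

end Spectral

/-! ### Eigenvalues of Laplacians and of the mixed matrix -/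

section Matrices

variable {n : ℕ}

theorem eig_monotone {A : Matrix (Fin n) (Fin n) ℝ} (hA : A.IsHermitian) : Monotone (eig hA) := by
  intro i j hij
  refine hA.eigenvalues₀_antitone ?_
  simpa [Fin.le_def] using Fin.rev_le_rev.2 hij

theorem exists_orthonormalBasis_eig {A : Matrix (Fin n) (Fin n) ℝ} (hA : A.IsHermitian) :
    ∃ b : OrthonormalBasis (Fin n) ℝ (EuclideanSpace ℝ (Fin n)),
      ∀ i, Matrix.toEuclideanCLM (n := Fin n) (𝕜 := ℝ) A (b i) = eig hA i • b i := by
  have hs := Matrix.isSymmetric_toEuclideanLin_iff.mpr hA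
  let e : Fin n ≃ Fin (Fintype.card (Fin n)) :=
    Fin.revPerm.trans (finCongr (Fintype.card_fin n).symm)
  refine ⟨(hs.eigenvectorBasis finrank_euclideanSpace).reindex e.symm, fun i => ?_⟩
  rw [OrthonormalBasis.reindex_apply]
  exact hs.apply_eigenvectorBasis finrank_euclideanSpace _

theorem dotProduct_lap_mulVec (G : WGraph n) (x : Fin n → ℝ) :
    x ⬝ᵥ G.lap.mulVec x = (∑ i, ∑ j, G.w i j * (x i - x j) ^ 2) / 2 := by
  have h1 : x ⬝ᵥ G.lap.mulVec x = ∑ i, ∑ j, G.w i j * x i ^ 2 - ∑ i, ∑ j, G.w i j * x i * x j := by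
    rw [WGraph.lap, Matrix.sub_mulVec, dotProduct_sub]
    congr 1
    · simp only [dotProduct, Matrix.mulVec_diagonal, WGraph.deg, Finset.mul_sum, Finset.sum_mul]
      exact Finset.sum_congr rfl fun i _ => Finset.sum_congr rfl fun j _ => by ring
    · simp only [dotProduct, Matrix.mulVec, Matrix.of_apply, Finset.mul_sum]
      exact Finset.sum_congr rfl fun i _ => Finset.sum_congr rfl fun j _ => by ring
  have h2 : ∑ i, ∑ j, G.w i j * x j ^ 2 = ∑ i, ∑ j, G.w i j * x i ^ 2 := by
    rw [Finset.sum_comm]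
    exact Finset.sum_congr rfl fun i _ => Finset.sum_congr rfl fun j _ => by rw [G.symm]
  have h3 : ∑ i, ∑ j, G.w i j * (x i - x j) ^ 2 = ∑ i, ∑ j, G.w i j * x i ^ 2 +
      ∑ i, ∑ j, G.w i j * x j ^ 2 - 2 * ∑ i, ∑ j, G.w i j * x i * x j := by
    simp only [Finset.mul_sum, ← Finset.sum_add_distrib, ← Finset.sum_sub_distrib]
    exact Finset.sum_congr rfl fun i _ => Finset.sum_congr rfl fun j _ => by ring
  rw [h1, h3, h2]
  ring

theorem lap_posSemidef (G : WGraph n) : G.lap.PosSemidef := by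
  refine Matrix.PosSemidef.of_dotProduct_mulVec_nonneg G.lap_isHermitian fun x => ?_
  rw [star_trivial, dotProduct_lap_mulVec]
  exact div_nonneg (Finset.sum_nonneg fun i _ => Finset.sum_nonneg fun j _ =>
    mul_nonneg (G.nonneg i j) (sq_nonneg _)) zero_le_two

theorem isUnit_det_one_add_lap (G : WGraph n) : IsUnit (1 + G.lap).det :=
  (Matrix.isUnit_iff_isUnit_det _).1 (Matrix.PosDef.one.add_posSemidef (lap_posSemidef G)).isUnit

theorem inner_toEuclideanCLM_lap_nonneg (G : WGraph n) (x : EuclideanSpace ℝ (Fin n)) :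
    0 ≤ ⟪x, Matrix.toEuclideanCLM (n := Fin n) (𝕜 := ℝ) G.lap x⟫ := by
  rw [Matrix.inner_toEuclideanCLM]
  simpa using (lap_posSemidef G).dotProduct_mulVec_nonneg x.ofLp

theorem eig_lap_nonneg (G : WGraph n) (i : Fin n) : 0 ≤ eig G.lap_isHermitian i := by
  obtain ⟨b, hb⟩ := exists_orthonormalBasis_eig G.lap_isHermitian
  rw [← inner_eigenvector_map hb i]
  exact inner_toEuclideanCLM_lap_nonneg G _

theorem abs_inner_toEuclideanCLM_le (A : Matrix (Fin n) (Fin n) ℝ) (x : EuclideanSpace ℝ (Fin n)) :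
    |⟪x, Matrix.toEuclideanCLM (n := Fin n) (𝕜 := ℝ) A x⟫| ≤ opNorm A * ‖x‖ ^ 2 := by
  refine (abs_real_inner_le_norm _ _).trans ?_
  have := (Matrix.toEuclideanCLM (n := Fin n) (𝕜 := ℝ) A).le_opNorm x
  calc _ ≤ ‖x‖ * (opNorm A * ‖x‖) := mul_le_mul_of_nonneg_left this (norm_nonneg _)
    _ = _ := by ring

theorem inner_mixed (G₁ G₂ : WGraph n) (x : EuclideanSpace ℝ (Fin n)) :
    ⟪x, Matrix.toEuclideanCLM (n := Fin n) (𝕜 := ℝ) (mixed G₁ G₂) x⟫ =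
      ⟪Matrix.toEuclideanCLM (n := Fin n) (𝕜 := ℝ) (1 + G₂.lap)⁻¹ x,
        Matrix.toEuclideanCLM (n := Fin n) (𝕜 := ℝ) G₁.lap
          (Matrix.toEuclideanCLM (n := Fin n) (𝕜 := ℝ) (1 + G₂.lap)⁻¹ x)⟫ := by
  have h : ((1 + G₂.lap)⁻¹).IsHermitian := (Matrix.isHermitian_one.add G₂.lap_isHermitian).inv
  rw [Matrix.inner_toEuclideanCLM, Matrix.inner_toEuclideanCLM, Matrix.ofLp_toEuclideanCLM, mixed,
    ← Matrix.mulVec_mulVec, ← Matrix.mulVec_mulVec, Matrix.dotProduct_mulVec,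
    ← Matrix.mulVec_transpose]
  have h' : ((1 + G₂.lap)⁻¹).transpose = (1 + G₂.lap)⁻¹ := by rwa [← Matrix.conjTranspose_eq_transpose_of_trivial]
  rw [h']

theorem inv_one_add_lap_apply (G : WGraph n) (x : EuclideanSpace ℝ (Fin n)) :
    Matrix.toEuclideanCLM (n := Fin n) (𝕜 := ℝ) (1 + G.lap)⁻¹
      (x + Matrix.toEuclideanCLM (n := Fin n) (𝕜 := ℝ) G.lap x) = x := by
  have h : (1 + G.lap)⁻¹ * (1 + G.lap) = 1 :=
    Matrix.nonsing_inv_mul _ (isUnit_det_one_add_lap G)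
  have h' := congrArg (fun A => Matrix.toEuclideanCLM (n := Fin n) (𝕜 := ℝ) A x) h
  simpa only [map_mul, map_add, map_one, mul_apply_eq_comp,
    add_apply, one_apply_eq_self] using h'

theorem one_add_lap_apply_inv (G : WGraph n) (x : EuclideanSpace ℝ (Fin n)) :
    Matrix.toEuclideanCLM (n := Fin n) (𝕜 := ℝ) (1 + G.lap)⁻¹ x +
      Matrix.toEuclideanCLM (n := Fin n) (𝕜 := ℝ) G.lap
        (Matrix.toEuclideanCLM (n := Fin n) (𝕜 := ℝ) (1 + G.lap)⁻¹ x) = x := by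
  have h : (1 + G.lap) * (1 + G.lap)⁻¹ = 1 :=
    Matrix.mul_nonsing_inv _ (isUnit_det_one_add_lap G)
  have h' := congrArg (fun A => Matrix.toEuclideanCLM (n := Fin n) (𝕜 := ℝ) A x) h
  simpa only [map_mul, map_add, map_one, mul_apply_eq_comp,
    add_apply, one_apply_eq_self] using h'

theorem abs_inner_lap_sub_le {G₁ G₂ : WGraph n} {Δ : ℝ} (hΔ : opNorm (G₁.lap - G₂.lap) ≤ Δ)
    (x : EuclideanSpace ℝ (Fin n)) :
    |⟪x, Matrix.toEuclideanCLM (n := Fin n) (𝕜 := ℝ) G₁.lap x⟫ -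
      ⟪x, Matrix.toEuclideanCLM (n := Fin n) (𝕜 := ℝ) G₂.lap x⟫| ≤ Δ * ‖x‖ ^ 2 := by
  have h := abs_inner_toEuclideanCLM_le (G₁.lap - G₂.lap) x
  rw [map_sub, sub_apply, inner_sub_right] at h
  exact h.trans (mul_le_mul_of_nonneg_right hΔ (sq_nonneg _))

theorem abs_eig_lap_sub_le {G₁ G₂ : WGraph n} {Δ : ℝ} (hΔ : opNorm (G₁.lap - G₂.lap) ≤ Δ)
    (i : Fin n) : |eig G₁.lap_isHermitian i - eig G₂.lap_isHermitian i| ≤ Δ := by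
  obtain ⟨b, hb⟩ := exists_orthonormalBasis_eig G₁.lap_isHermitian
  obtain ⟨c, hc⟩ := exists_orthonormalBasis_eig G₂.lap_isHermitian
  have h := fun x => abs_le.1 (abs_inner_lap_sub_le hΔ x)
  have h1 := eigenvalue_le_add hb hc (eig_monotone _) (eig_monotone _) (Δ := Δ)
    (fun x => by linarith [(h x).2]) i
  have h2 := eigenvalue_le_add hc hb (eig_monotone _) (eig_monotone _) (Δ := Δ)
    (fun x => by linarith [(h x).1]) i
  exact abs_le.2 ⟨by linarith, by linarith⟩

variable [NeZero n] {G₁ G₂ : WGraph n} {Δ : ℝ}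

/-- The Rayleigh bound for the mixed matrix at `(1 + L) x`, which removes both inverses. -/
theorem inner_lap_le_mixedTop_mul (G₁ G₂ : WGraph n) (x : EuclideanSpace ℝ (Fin n)) :
    ⟪x, Matrix.toEuclideanCLM (n := Fin n) (𝕜 := ℝ) G₁.lap x⟫ ≤
      mixedTop G₁ G₂ * ‖x + Matrix.toEuclideanCLM (n := Fin n) (𝕜 := ℝ) G₂.lap x‖ ^ 2 := by
  obtain ⟨b, hb⟩ := exists_orthonormalBasis_eig (mixed_isHermitian G₁ G₂)
  have h := inner_map_self_le hb (B := mixedTop G₁ G₂) (fun i => eig_monotone _ le_top)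
    (x + Matrix.toEuclideanCLM (n := Fin n) (𝕜 := ℝ) G₂.lap x)
  rwa [inner_mixed, inv_one_add_lap_apply] at h

/-- The test vector is the unit eigenvector of `L` for its `i`-th eigenvalue `ν`: there `M` is at
least `ν - Δ ≥ λ - 2Δ`, while `‖x + L x‖ = 1 + ν ≤ 1 + λ + Δ`. -/
theorem maxOver_le_mixedTop (hΔ : opNorm (G₁.lap - G₂.lap) ≤ Δ) :
    maxOver (fun i => (eig G₁.lap_isHermitian i - 2 * Δ) /
      (1 + eig G₁.lap_isHermitian i + Δ) ^ 2) ≤ mixedTop G₁ G₂ := by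
  refine Finset.sup'_le _ _ fun i _ => ?_
  have hΔ0 : 0 ≤ Δ := (norm_nonneg _).trans hΔ
  obtain ⟨b, hb⟩ := exists_orthonormalBasis_eig G₂.lap_isHermitian
  have hν := eig_lap_nonneg G₂ i
  have hlam := eig_lap_nonneg G₁ i
  obtain ⟨h1, h2⟩ := abs_le.1 (abs_eig_lap_sub_le hΔ i)
  have h3 := (abs_le.1 (abs_inner_lap_sub_le hΔ (b i))).1
  have h4 := inner_lap_le_mixedTop_mul G₁ G₂ (b i)
  have h5 := inner_toEuclideanCLM_lap_nonneg G₁ (b i)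
  have hn : ‖b i + Matrix.toEuclideanCLM (n := Fin n) (𝕜 := ℝ) G₂.lap (b i)‖ =
      1 + eig G₂.lap_isHermitian i := by
    have h6 : b i + eig G₂.lap_isHermitian i • b i = (1 + eig G₂.lap_isHermitian i) • b i := by
      rw [add_smul, one_smul]
    rw [hb, h6, norm_smul, b.norm_eq_one, mul_one, Real.norm_of_nonneg (by linarith)]
  rw [inner_eigenvector_map hb, b.norm_eq_one] at h3
  rw [hn] at h4
  -- Replacing `ν` by the larger `λ + Δ` in the square is legitimate only because the top eigenvalue
  -- is nonnegative.
  have htop : 0 ≤ mixedTop G₁ G₂ :=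
    nonneg_of_mul_nonneg_left (h5.trans h4) (by positivity)
  rw [div_le_iff₀ (by positivity)]
  have h6 : mixedTop G₁ G₂ * (1 + eig G₂.lap_isHermitian i) ^ 2 ≤
      mixedTop G₁ G₂ * (1 + eig G₁.lap_isHermitian i + Δ) ^ 2 :=
    mul_le_mul_of_nonneg_left (pow_le_pow_left₀ (by linarith) (by linarith) 2) htop
  linarith

/-- Since `ν + Δ ≤ λ + 2Δ` and `d ≤ 1 + ν`, the maximum is an admissible `B` in `M ≤ B (1 + L)²`;
this is then read at `(1 + L)⁻¹` of a top eigenvector. Leaving `d` free serves both upper bounds. -/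
theorem mixedTop_le_maxOver (hΔ : opNorm (G₁.lap - G₂.lap) ≤ Δ) {d : Fin n → ℝ}
    (hd : ∀ i, 0 < d i) (hd' : ∀ i, d i ≤ 1 + eig G₂.lap_isHermitian i) :
    mixedTop G₁ G₂ ≤ maxOver (fun i => (eig G₁.lap_isHermitian i + 2 * Δ) / d i ^ 2) := by
  have hΔ0 : 0 ≤ Δ := (norm_nonneg _).trans hΔ
  obtain ⟨b, hb⟩ := exists_orthonormalBasis_eig G₂.lap_isHermitian
  obtain ⟨c, hc⟩ := exists_orthonormalBasis_eig (mixed_isHermitian G₁ G₂)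
  have h := inner_map_self_le_of_resolvent hb
    (M := Matrix.toEuclideanCLM (n := Fin n) (𝕜 := ℝ) G₁.lap) (Δ := Δ)
    (B := maxOver (fun i => (eig G₁.lap_isHermitian i + 2 * Δ) / d i ^ 2))
    (fun x => by linarith [(abs_le.1 (abs_inner_lap_sub_le hΔ x)).2]) (fun i => ?_)
    (Matrix.toEuclideanCLM (n := Fin n) (𝕜 := ℝ) (1 + G₂.lap)⁻¹ (c ⊤))
  · rw [one_add_lap_apply_inv, ← inner_mixed, inner_eigenvector_map hc, c.norm_eq_one] at h
    simpa [mixedTop] using h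
  · have hlam := eig_lap_nonneg G₁ i
    have h1 := (abs_le.1 (abs_eig_lap_sub_le hΔ i)).1
    have hmax : (eig G₁.lap_isHermitian i + 2 * Δ) / d i ^ 2 ≤
        maxOver (fun i => (eig G₁.lap_isHermitian i + 2 * Δ) / d i ^ 2) :=
      Finset.le_sup' (fun i => (eig G₁.lap_isHermitian i + 2 * Δ) / d i ^ 2) (Finset.mem_univ i)
    have hd2 : 0 < d i ^ 2 := pow_pos (hd i) 2
    calc eig G₂.lap_isHermitian i + Δ ≤ eig G₁.lap_isHermitian i + 2 * Δ := by linarith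
      _ = (eig G₁.lap_isHermitian i + 2 * Δ) / d i ^ 2 * d i ^ 2 :=
        (div_mul_cancel₀ _ hd2.ne').symm
      _ ≤ (eig G₁.lap_isHermitian i + 2 * Δ) / d i ^ 2 * (1 + eig G₂.lap_isHermitian i) ^ 2 :=
        mul_le_mul_of_nonneg_left (pow_le_pow_left₀ (hd i).le (hd' i) 2) (by positivity)
      _ ≤ _ := mul_le_mul_of_nonneg_right hmax (sq_nonneg _)

end Matrices

end MixedGraph

namespace MixedGraph

/-! ### From disjoint sets to arbitrary pairs of sets -/

section Discrepancy

variable {ι : Type*} [DecidableEq ι] {a : ι → ι → ℝ}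

/-- A large cut: a set with the weights `a` can be split in such a way that the cut carries
at least half of the total weight. -/
theorem exists_subset_sum_le_four_mul (hsymm : ∀ i j, a i j = a j i) (hdiag : ∀ i, a i i = 0)
    (U : Finset ι) :
    ∃ S ⊆ U, ∑ i ∈ U, ∑ j ∈ U, a i j ≤ 4 * ∑ i ∈ S, ∑ j ∈ U \ S, a i j := by
  induction U using Finset.induction_on with
  | empty => exact ⟨∅, subset_rfl, by simp⟩
  | insert v U hv ih =>
    obtain ⟨S, hSU, hS⟩ := ih
    have hvS : v ∉ S := fun h => hv (hSU h)
    have hsum : ∑ i ∈ insert v U, ∑ j ∈ insert v U, a i j =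
        ∑ i ∈ U, ∑ j ∈ U, a i j + 2 * ∑ j ∈ U, a v j := by
      simp only [Finset.sum_insert hv, Finset.sum_add_distrib, hdiag, hsymm _ v]
      ring
    have hsplit : ∑ j ∈ U \ S, a v j + ∑ j ∈ S, a v j = ∑ j ∈ U, a v j :=
      Finset.sum_sdiff hSU
    -- Greedy choice: `v` goes opposite the side to which it has more weight, so the cut gains at
    -- least half of its total weight. The double sum counts each pair twice, hence 4. No sign
    -- condition on `a` is needed.
    rcases le_total (∑ j ∈ S, a v j) (∑ j ∈ U \ S, a v j) with h | h
    · refine ⟨insert v S, Finset.insert_subset_insert v hSU, ?_⟩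
      have hd : insert v U \ insert v S = U \ S := by
        rw [Finset.insert_sdiff_insert, Finset.sdiff_insert_of_notMem hv]
      rw [hsum, hd, Finset.sum_insert hvS]
      linarith
    · refine ⟨S, hSU.trans (Finset.subset_insert v U), ?_⟩
      rw [hsum, Finset.insert_sdiff_of_notMem U hvS]
      simp only [Finset.sum_insert (fun h => hv (Finset.mem_sdiff.1 h).1 : v ∉ U \ S),
        Finset.sum_add_distrib, hsymm _ v]
      linarith

theorem sqrt_mul_le_half_add {x y : ℝ} (hx : 0 ≤ x) (hy : 0 ≤ y) : √(x * y) ≤ (x + y) / 2 := by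
  refine Real.sqrt_le_iff.2 ⟨by positivity, ?_⟩
  nlinarith [sq_nonneg (x - y)]

theorem sum_sum_self_le (hsymm : ∀ i j, a i j = a j i) (hdiag : ∀ i, a i i = 0) {ε : ℝ}
    (hε : 0 ≤ ε) (h : ∀ S T : Finset ι, Disjoint S T →
      |∑ i ∈ S, ∑ j ∈ T, a i j| ≤ ε * √((S.card : ℝ) * (T.card : ℝ))) (U : Finset ι) :
    ∑ i ∈ U, ∑ j ∈ U, a i j ≤ 2 * ε * U.card := by
  obtain ⟨S, hSU, hS⟩ := exists_subset_sum_le_four_mul hsymm hdiag U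
  have h1 := (abs_le.1 (h S (U \ S) Finset.disjoint_sdiff)).2
  have h2 := sqrt_mul_le_half_add (x := (S.card : ℝ)) (y := ((U \ S).card : ℝ)) (by positivity)
    (by positivity)
  have h3 : ((U \ S).card : ℝ) + S.card = U.card := by
    exact_mod_cast Finset.card_sdiff_add_card_eq_card hSU
  have h4 := mul_le_mul_of_nonneg_left h2 hε
  have h5 : ε * (((S.card : ℝ) + ((U \ S).card : ℝ)) / 2) = ε * U.card / 2 := by
    rw [← h3]
    ring
  linarith

theorem abs_sum_sum_self_le (hsymm : ∀ i j, a i j = a j i) (hdiag : ∀ i, a i i = 0) {ε : ℝ}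
    (hε : 0 ≤ ε) (h : ∀ S T : Finset ι, Disjoint S T →
      |∑ i ∈ S, ∑ j ∈ T, a i j| ≤ ε * √((S.card : ℝ) * (T.card : ℝ))) (U : Finset ι) :
    |∑ i ∈ U, ∑ j ∈ U, a i j| ≤ 2 * ε * U.card := by
  have h1 := sum_sum_self_le hsymm hdiag hε h U
  have h2 := sum_sum_self_le (a := fun i j => -a i j) (fun i j => by rw [hsymm])
    (fun i => by rw [hdiag, neg_zero]) hε
    (fun S T hST => by simpa only [Finset.sum_neg_distrib, abs_neg] using h S T hST) U
  simp only [Finset.sum_neg_distrib] at h2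
  exact abs_le.2 ⟨by linarith, h1⟩

/-- Split `S × T` into `(S \ T) × T`, `(S ∩ T) × (T \ S)` and `(S ∩ T) × (S ∩ T)`. The first two are
disjoint pairs costing `ε` each; the last costs `2 * ε`, because `|S ∩ T| ≤ √(|S| |T|)`. -/
theorem abs_sum_sum_le_four_mul (hsymm : ∀ i j, a i j = a j i) (hdiag : ∀ i, a i i = 0) {ε : ℝ}
    (hε : 0 ≤ ε) (h : ∀ S T : Finset ι, Disjoint S T →
      |∑ i ∈ S, ∑ j ∈ T, a i j| ≤ ε * √((S.card : ℝ) * (T.card : ℝ))) (S T : Finset ι) :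
    |∑ i ∈ S, ∑ j ∈ T, a i j| ≤ 4 * ε * √((S.card : ℝ) * (T.card : ℝ)) := by
  have hmono : ∀ {S' T' : Finset ι}, S' ⊆ S → T' ⊆ T →
      √((S'.card : ℝ) * (T'.card : ℝ)) ≤ √((S.card : ℝ) * (T.card : ℝ)) := fun hS hT =>
    Real.sqrt_le_sqrt (mul_le_mul (by exact_mod_cast Finset.card_le_card hS)
      (by exact_mod_cast Finset.card_le_card hT) (by positivity) (by positivity))
  have hsplit : ∑ i ∈ S, ∑ j ∈ T, a i j = ∑ i ∈ S \ T, ∑ j ∈ T, a i j +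
      (∑ i ∈ S ∩ T, ∑ j ∈ T \ S, a i j + ∑ i ∈ S ∩ T, ∑ j ∈ S ∩ T, a i j) := by
    rw [← Finset.sum_add_distrib]
    have : ∀ i, ∑ j ∈ T \ S, a i j + ∑ j ∈ S ∩ T, a i j = ∑ j ∈ T, a i j := fun i => by
      rw [Finset.inter_comm, add_comm, Finset.sum_inter_add_sum_sdiff]
    simp only [this]
    rw [add_comm, Finset.sum_inter_add_sum_sdiff]
  have h1 := (h (S \ T) T Finset.sdiff_disjoint).trans
    (mul_le_mul_of_nonneg_left (hmono Finset.sdiff_subset subset_rfl) hε)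
  have h2 := (h (S ∩ T) (T \ S) (Finset.disjoint_sdiff.mono_left Finset.inter_subset_left)).trans
    (mul_le_mul_of_nonneg_left (hmono Finset.inter_subset_left Finset.sdiff_subset) hε)
  have h3 := abs_sum_sum_self_le hsymm hdiag hε h (S ∩ T)
  have h4 : ((S ∩ T).card : ℝ) ≤ √((S.card : ℝ) * (T.card : ℝ)) := by
    have := hmono (S' := S ∩ T) (T' := S ∩ T) Finset.inter_subset_left Finset.inter_subset_right
    rwa [Real.sqrt_mul_self (by positivity)] at this
  have h5 := mul_le_mul_of_nonneg_left h4 (by positivity : 0 ≤ 2 * ε)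
  rw [hsplit]
  refine (abs_add_le _ _).trans ?_
  refine (add_le_add_right (abs_add_le _ _) _).trans ?_
  linarith

end Discrepancy

/-! ### Dyadic decomposition of the bilinear form -/

section Dyadic

/-- Subtraction is truncated: the terms with `m < K` equal 1, and the rest form a geometric series.
-/
theorem sum_range_half_pow_sub_le (K N : ℕ) :
    ∑ m ∈ Finset.range N, (1 / 2 : ℝ) ^ (m - K) ≤ K + 2 := by
  calc ∑ m ∈ Finset.range N, (1 / 2 : ℝ) ^ (m - K)
      ≤ ∑ m ∈ Finset.range (K + N), (1 / 2 : ℝ) ^ (m - K) :=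
        Finset.sum_le_sum_of_subset_of_nonneg (Finset.range_mono (by omega))
          fun _ _ _ => by positivity
    _ = ∑ m ∈ Finset.range K, (1 / 2 : ℝ) ^ (m - K) + ∑ m ∈ Finset.range N, (1 / 2 : ℝ) ^ m := by
        rw [Finset.sum_range_add]
        simp
    _ ≤ K + 2 := by
        refine add_le_add ?_ (sum_geometric_two_le N)
        refine (Finset.sum_le_card_nsmul _ _ 1 fun m _ => ?_).trans (by simp)
        exact pow_le_one₀ (by norm_num) (by norm_num)

theorem sum_range_half_pow_dist_sub_le (K N k : ℕ) :
    ∑ l ∈ Finset.range N, (1 / 2 : ℝ) ^ (Nat.dist k l - K) ≤ 2 * (K + 2) := by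
  calc ∑ l ∈ Finset.range N, (1 / 2 : ℝ) ^ (Nat.dist k l - K)
      ≤ ∑ l ∈ Finset.range (k + N), (1 / 2 : ℝ) ^ (Nat.dist k l - K) :=
        Finset.sum_le_sum_of_subset_of_nonneg (Finset.range_mono (by omega))
          fun _ _ _ => by positivity
    _ = ∑ m ∈ Finset.range k, (1 / 2 : ℝ) ^ (m + 1 - K) +
          ∑ m ∈ Finset.range N, (1 / 2 : ℝ) ^ (m - K) := by
        rw [Finset.sum_range_add, ← Finset.sum_range_reflect]
        congr 1
        · refine Finset.sum_congr rfl fun l hl => ?_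
          rw [Finset.mem_range] at hl
          congr 2
          unfold Nat.dist
          omega
        · refine Finset.sum_congr rfl fun l _ => ?_
          congr 2
          unfold Nat.dist
          omega
    _ ≤ (K + 2) + (K + 2) := by
        refine add_le_add ?_ (sum_range_half_pow_sub_le K N)
        refine le_trans ?_ (sum_range_half_pow_sub_le K (k + 1))
        rw [Finset.sum_range_succ']
        exact le_add_of_nonneg_right (by positivity)
    _ = 2 * (K + 2) := by ring

theorem two_pow_mul_abs_le_of_far {k l K : ℕ} {c η e t : ℝ} (ht : 0 ≤ t)
    (hη : η ≤ c * 2 ^ K) (he : |e| ≤ η * t) (hkl : k + K < l) :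
    2 ^ k * 2 ^ l * |e| ≤ c * (4 ^ l * t) * (1 / 2) ^ (Nat.dist k l - K) := by
  obtain ⟨m, rfl⟩ : ∃ m, l = k + K + m := ⟨l - (k + K), by omega⟩
  have hd : Nat.dist k (k + K + m) - K = m := by
    unfold Nat.dist
    omega
  have h4 : (4 : ℝ) ^ (k + K + m) = 2 ^ (k + K + m) * 2 ^ (k + K + m) := by
    rw [← mul_pow]
    norm_num
  have h2 : (1 / 2 : ℝ) ^ m * 2 ^ m = 1 := by
    rw [← mul_pow]
    norm_num
  rw [hd, h4]
  calc (2 : ℝ) ^ k * 2 ^ (k + K + m) * |e| ≤ 2 ^ k * 2 ^ (k + K + m) * (c * 2 ^ K * t) :=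
        mul_le_mul_of_nonneg_left (he.trans (mul_le_mul_of_nonneg_right hη ht)) (by positivity)
    _ = c * (2 ^ (k + K) * 2 ^ (k + K + m) * t) * ((1 / 2 : ℝ) ^ m * 2 ^ m) := by
        rw [h2, pow_add 2 k K]
        ring
    _ = c * (2 ^ (k + K + m) * 2 ^ (k + K + m) * t) * (1 / 2) ^ m := by
        rw [pow_add 2 (k + K) m]
        ring

/-- For `|k - l| ≤ K` the discrepancy bound and AM-GM suffice. For levels further apart, the trivial
bound by `η` times the size at the higher level gains a factor `1 / 2` for each step beyond `K`. -/
theorem two_pow_mul_abs_le {k l K : ℕ} {c η e s t : ℝ} (hc : 0 ≤ c) (hs : 0 ≤ s) (ht : 0 ≤ t)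
    (hη : η ≤ c * 2 ^ K) (he : |e| ≤ c * √(s * t)) (hes : |e| ≤ η * s) (het : |e| ≤ η * t) :
    2 ^ k * 2 ^ l * |e| ≤ c * (4 ^ k * s + 4 ^ l * t) * (1 / 2) ^ (Nat.dist k l - K) := by
  rcases lt_or_ge (k + K) l with h | h
  · refine (two_pow_mul_abs_le_of_far ht hη het h).trans ?_
    gcongr
    exact le_add_of_nonneg_left (by positivity)
  rcases lt_or_ge (l + K) k with h' | h'
  · rw [mul_comm (2 ^ k : ℝ)]
    refine (two_pow_mul_abs_le_of_far hs hη hes h').trans ?_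
    rw [Nat.dist_comm]
    gcongr
    exact le_add_of_nonneg_right (by positivity)
  have hd : Nat.dist k l - K = 0 := by
    unfold Nat.dist
    omega
  have h4 : ∀ m, (4 : ℝ) ^ m = 2 ^ m * 2 ^ m := fun m => by
    rw [← mul_pow]
    norm_num
  have hsq : 2 ^ k * 2 ^ l * √(s * t) = √((4 ^ k * s) * (4 ^ l * t)) := by
    rw [h4, h4, show (2 : ℝ) ^ k * 2 ^ k * s * (2 ^ l * 2 ^ l * t) =
      (2 ^ k * 2 ^ l) ^ 2 * (s * t) by ring, Real.sqrt_mul (sq_nonneg _) (s * t),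
      Real.sqrt_sq (by positivity)]
  rw [hd, pow_zero, mul_one]
  calc 2 ^ k * 2 ^ l * |e| ≤ 2 ^ k * 2 ^ l * (c * √(s * t)) :=
        mul_le_mul_of_nonneg_left he (by positivity)
    _ = c * √((4 ^ k * s) * (4 ^ l * t)) := by
        rw [← hsq]
        ring
    _ ≤ c * (4 ^ k * s + 4 ^ l * t) := by
        refine mul_le_mul_of_nonneg_left ?_ hc
        refine (sqrt_mul_le_half_add (by positivity) (by positivity)).trans ?_
        have : 0 ≤ 4 ^ k * s + 4 ^ l * t := by positivity
        linarith

/-- The two halves of the termwise bound are summed separately, each first over the level it does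
not involve; that inner sum is at most `2 * (K + 2)`. -/
theorem abs_dyadic_sum_le {K N : ℕ} {c η : ℝ} {e : ℕ → ℕ → ℝ} {s t : ℕ → ℝ} (hc : 0 ≤ c)
    (hs : ∀ k, 0 ≤ s k) (ht : ∀ k, 0 ≤ t k) (hη : η ≤ c * 2 ^ K)
    (he : ∀ k l, |e k l| ≤ c * √(s k * t l)) (hes : ∀ k l, |e k l| ≤ η * s k)
    (het : ∀ k l, |e k l| ≤ η * t l) :
    |∑ k ∈ Finset.range N, ∑ l ∈ Finset.range N, 2 ^ k * 2 ^ l * e k l| ≤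
      c * (2 * (K + 2)) *
        (∑ k ∈ Finset.range N, 4 ^ k * s k + ∑ k ∈ Finset.range N, 4 ^ k * t k) := by
  have key : ∀ u : ℕ → ℝ, (∀ k, 0 ≤ u k) →
      ∑ k ∈ Finset.range N, ∑ l ∈ Finset.range N,
        c * (4 ^ k * u k) * (1 / 2) ^ (Nat.dist k l - K) ≤
      c * (2 * (K + 2)) * ∑ k ∈ Finset.range N, 4 ^ k * u k := fun u hu => by
    rw [Finset.mul_sum]
    refine Finset.sum_le_sum fun k _ => ?_
    rw [← Finset.mul_sum]
    have := mul_le_mul_of_nonneg_left (sum_range_half_pow_dist_sub_le K N k)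
      (mul_nonneg hc (mul_nonneg (by positivity : (0 : ℝ) ≤ 4 ^ k) (hu k)))
    linarith
  calc |∑ k ∈ Finset.range N, ∑ l ∈ Finset.range N, 2 ^ k * 2 ^ l * e k l|
      ≤ ∑ k ∈ Finset.range N, ∑ l ∈ Finset.range N, 2 ^ k * 2 ^ l * |e k l| := by
        refine (Finset.abs_sum_le_sum_abs _ _).trans (Finset.sum_le_sum fun k _ => ?_)
        refine (Finset.abs_sum_le_sum_abs _ _).trans (Finset.sum_le_sum fun l _ => ?_)
        rw [abs_mul, abs_of_pos (by positivity : (0 : ℝ) < 2 ^ k * 2 ^ l)]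
    _ ≤ ∑ k ∈ Finset.range N, ∑ l ∈ Finset.range N,
          c * (4 ^ k * s k + 4 ^ l * t l) * (1 / 2) ^ (Nat.dist k l - K) :=
        Finset.sum_le_sum fun k _ => Finset.sum_le_sum fun l _ =>
          two_pow_mul_abs_le hc (hs k) (ht l) hη (he k l) (hes k l) (het k l)
    _ = ∑ k ∈ Finset.range N, ∑ l ∈ Finset.range N,
          c * (4 ^ k * s k) * (1 / 2) ^ (Nat.dist k l - K) +
        ∑ l ∈ Finset.range N, ∑ k ∈ Finset.range N,
          c * (4 ^ l * t l) * (1 / 2) ^ (Nat.dist l k - K) := by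
        rw [Finset.sum_comm (f := fun l k => c * (4 ^ l * t l) * (1 / 2 : ℝ) ^ (Nat.dist l k - K)),
          ← Finset.sum_add_distrib]
        refine Finset.sum_congr rfl fun k _ => ?_
        rw [← Finset.sum_add_distrib]
        refine Finset.sum_congr rfl fun l _ => ?_
        rw [Nat.dist_comm l k]
        ring
    _ ≤ _ := by
        rw [mul_add]
        exact add_le_add (key s hs) (key t ht)

theorem sum_range_two_pow_testBit {x N : ℕ} (hx : x < 2 ^ N) :
    ∑ k ∈ Finset.range N, (if x.testBit k then 2 ^ k else 0) = x := by
  rw [← Finset.sum_filter]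
  conv_rhs => rw [← Finset.sum_toFinset_bitIndices_two_pow x]
  refine Finset.sum_congr ?_ fun _ _ => rfl
  ext k
  simp only [Finset.mem_filter, Finset.mem_range, List.mem_toFinset, Nat.mem_bitIndices,
    and_iff_right_iff_imp]
  intro h
  by_contra! hk
  rw [Nat.testBit_lt_two_pow (hx.trans_le (Nat.pow_le_pow_right two_pos hk))] at h
  exact Bool.false_ne_true h

theorem sum_range_four_pow_testBit_le {x N : ℕ} (hx : x < 2 ^ N) :
    ∑ k ∈ Finset.range N, (if x.testBit k then 4 ^ k else 0) ≤ x ^ 2 := by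
  conv_rhs => rw [← sum_range_two_pow_testBit hx]
  refine le_trans (Finset.sum_le_sum fun k _ => ?_)
    (Finset.sum_sq_le_sq_sum_of_nonneg fun _ _ => Nat.zero_le _)
  split_ifs
  · rw [← pow_mul, mul_comm, pow_mul]
    norm_num
  · simp

variable {ι : Type*} [Fintype ι] {a : ι → ι → ℝ}

/-- Binary digits write `x` exactly as a sum of `2 ^ k` times indicators of level sets, so the form
becomes a dyadic sum of cut values. The sum of `4 ^ k` times the level set sizes is at most `∑ x i ^
2`, since squares of nonnegative terms sum to at most the square of their sum. -/
theorem abs_bilin_natCast_le {K : ℕ} {c η : ℝ} (hc : 0 ≤ c) (hη : η ≤ c * 2 ^ K)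
    (hcut : ∀ S T : Finset ι, |∑ i ∈ S, ∑ j ∈ T, a i j| ≤ c * √((S.card : ℝ) * (T.card : ℝ)))
    (hS : ∀ S T : Finset ι, |∑ i ∈ S, ∑ j ∈ T, a i j| ≤ η * S.card)
    (hT : ∀ S T : Finset ι, |∑ i ∈ S, ∑ j ∈ T, a i j| ≤ η * T.card) (x y : ι → ℕ) :
    |∑ i, ∑ j, a i j * x i * y j| ≤
      c * (2 * (K + 2)) * (∑ i, (x i : ℝ) ^ 2 + ∑ i, (y i : ℝ) ^ 2) := by
  obtain ⟨N, hx, hy⟩ : ∃ N, (∀ i, x i < 2 ^ N) ∧ ∀ i, y i < 2 ^ N := by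
    refine ⟨∑ i, x i + ∑ i, y i, fun i => ?_, fun i => ?_⟩
    · refine Nat.lt_two_pow_self.trans_le (Nat.pow_le_pow_right two_pos ?_)
      exact (Finset.single_le_sum (fun _ _ => Nat.zero_le _) (Finset.mem_univ i)).trans
        (Nat.le_add_right _ _)
    · refine Nat.lt_two_pow_self.trans_le (Nat.pow_le_pow_right two_pos ?_)
      exact (Finset.single_le_sum (fun _ _ => Nat.zero_le _) (Finset.mem_univ i)).trans
        (Nat.le_add_left _ _)
  have hbit : ∀ z : ι → ℕ, (∀ i, z i < 2 ^ N) → ∀ i,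
      (z i : ℝ) = ∑ k ∈ Finset.range N, if (z i).testBit k then (2 : ℝ) ^ k else 0 := fun z hz i => by
    conv_lhs => rw [← sum_range_two_pow_testBit (hz i)]
    push_cast
    rfl
  have hcard : ∀ z : ι → ℕ, (∀ i, z i < 2 ^ N) → ∑ k ∈ Finset.range N,
      (4 : ℝ) ^ k * ((Finset.univ.filter fun i => (z i).testBit k).card : ℝ) ≤
        ∑ i, (z i : ℝ) ^ 2 := fun z hz => by
    have h1 : ∀ k, (4 : ℝ) ^ k * ((Finset.univ.filter fun i => (z i).testBit k).card : ℝ) =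
        ∑ i, if (z i).testBit k then (4 : ℝ) ^ k else 0 := fun k => by
      rw [← Finset.sum_filter, Finset.sum_const, nsmul_eq_mul, mul_comm]
    simp only [h1]
    rw [Finset.sum_comm]
    refine Finset.sum_le_sum fun i _ => ?_
    exact_mod_cast sum_range_four_pow_testBit_le (hz i)
  have hexp : ∑ i, ∑ j, a i j * x i * y j = ∑ k ∈ Finset.range N, ∑ l ∈ Finset.range N,
      2 ^ k * 2 ^ l * ∑ i ∈ Finset.univ.filter (fun i => (x i).testBit k),
        ∑ j ∈ Finset.univ.filter (fun j => (y j).testBit l), a i j := by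
    have h1 : ∀ i j, a i j * x i * y j = ∑ k ∈ Finset.range N, ∑ l ∈ Finset.range N,
        2 ^ k * 2 ^ l * (if (x i).testBit k then if (y j).testBit l then a i j else 0 else 0) :=
      fun i j => by
        rw [hbit x hx i, hbit y hy j, mul_assoc, Finset.sum_mul_sum, Finset.mul_sum]
        refine Finset.sum_congr rfl fun k _ => ?_
        rw [Finset.mul_sum]
        refine Finset.sum_congr rfl fun l _ => ?_
        split_ifs <;> ring
    simp only [h1]
    have h2 : ∀ i, ∑ j, ∑ k ∈ Finset.range N, ∑ l ∈ Finset.range N,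
        2 ^ k * 2 ^ l * (if (x i).testBit k then if (y j).testBit l then a i j else 0 else 0) =
        ∑ k ∈ Finset.range N, ∑ l ∈ Finset.range N, ∑ j,
        2 ^ k * 2 ^ l * (if (x i).testBit k then if (y j).testBit l then a i j else 0 else 0) :=
      fun i => by
        rw [Finset.sum_comm]
        exact Finset.sum_congr rfl fun k _ => Finset.sum_comm
    simp only [h2]
    rw [Finset.sum_comm]
    refine Finset.sum_congr rfl fun k _ => ?_
    rw [Finset.sum_comm]
    refine Finset.sum_congr rfl fun l _ => ?_
    rw [Finset.sum_filter, Finset.mul_sum]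
    refine Finset.sum_congr rfl fun i _ => ?_
    split_ifs
    · rw [Finset.sum_filter, Finset.mul_sum]
    · simp
  rw [hexp]
  refine (abs_dyadic_sum_le
    (s := fun k => ((Finset.univ.filter fun i => (x i).testBit k).card : ℝ))
    (t := fun k => ((Finset.univ.filter fun i => (y i).testBit k).card : ℝ)) hc
    (fun _ => by positivity) (fun _ => by positivity) hη (fun _ _ => hcut _ _)
    (fun _ _ => hS _ _) (fun _ _ => hT _ _)).trans ?_
  exact mul_le_mul_of_nonneg_left (add_le_add (hcard x hx) (hcard y hy)) (by positivity)

end Dyadic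

end MixedGraph

namespace MixedGraph

/-! ### From integer to real vectors, and the converse mixing lemma -/

section Bilinear

open Filter Topology

variable {ι : Type*} [Fintype ι] {a : ι → ι → ℝ}

/-- Both sides are homogeneous of degree two, so the integer bound passes to `⌊x i * t⌋₊ / t`, and
then to the limit `t → ∞`. -/
theorem abs_bilin_le_of_nonneg {B : ℝ}
    (h : ∀ x y : ι → ℕ, |∑ i, ∑ j, a i j * x i * y j| ≤
      B * (∑ i, (x i : ℝ) ^ 2 + ∑ i, (y i : ℝ) ^ 2))
    {x y : ι → ℝ} (hx : ∀ i, 0 ≤ x i) (hy : ∀ i, 0 ≤ y i) :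
    |∑ i, ∑ j, a i j * x i * y j| ≤ B * (∑ i, x i ^ 2 + ∑ i, y i ^ 2) := by
  have hX : ∀ i, Tendsto (fun t : ℝ => (⌊x i * t⌋₊ : ℝ) / t) atTop (𝓝 (x i)) := fun i =>
    tendsto_nat_floor_mul_div_atTop (hx i)
  have hY : ∀ i, Tendsto (fun t : ℝ => (⌊y i * t⌋₊ : ℝ) / t) atTop (𝓝 (y i)) := fun i =>
    tendsto_nat_floor_mul_div_atTop (hy i)
  have h1 : Tendsto (fun t : ℝ => |∑ i, ∑ j, a i j * ((⌊x i * t⌋₊ : ℝ) / t) *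
      ((⌊y j * t⌋₊ : ℝ) / t)|) atTop (𝓝 |∑ i, ∑ j, a i j * x i * y j|) :=
    (tendsto_finsetSum _ fun i _ => tendsto_finsetSum _ fun j _ =>
      ((hX i).const_mul (a i j)).mul (hY j)).abs
  have h2 : Tendsto (fun t : ℝ => B * (∑ i, ((⌊x i * t⌋₊ : ℝ) / t) ^ 2 +
      ∑ i, ((⌊y i * t⌋₊ : ℝ) / t) ^ 2)) atTop (𝓝 (B * (∑ i, x i ^ 2 + ∑ i, y i ^ 2))) :=
    ((tendsto_finsetSum _ fun i _ => (hX i).pow 2).add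
      (tendsto_finsetSum _ fun i _ => (hY i).pow 2)).const_mul B
  refine le_of_tendsto_of_tendsto h1 h2 ?_
  filter_upwards [eventually_gt_atTop (0 : ℝ)] with t ht
  have h3 := h (fun i => ⌊x i * t⌋₊) (fun i => ⌊y i * t⌋₊)
  have e1 : ∑ i, ∑ j, a i j * ((⌊x i * t⌋₊ : ℝ) / t) * ((⌊y j * t⌋₊ : ℝ) / t) =
      (∑ i, ∑ j, a i j * (⌊x i * t⌋₊ : ℝ) * (⌊y j * t⌋₊ : ℝ)) / t ^ 2 := by
    simp only [Finset.sum_div]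
    exact Finset.sum_congr rfl fun i _ => Finset.sum_congr rfl fun j _ => by ring
  have e2 : ∀ z : ι → ℝ, ∑ i, ((⌊z i * t⌋₊ : ℝ) / t) ^ 2 =
      (∑ i, (⌊z i * t⌋₊ : ℝ) ^ 2) / t ^ 2 := fun z => by
    simp only [Finset.sum_div, div_pow]
  change |_| ≤ _
  rw [e1, e2, e2, abs_div, abs_of_pos (pow_pos ht 2), ← add_div, ← mul_div_assoc]
  exact div_le_div_of_nonneg_right h3 (by positivity)

/-- Positive and negative parts give four nonnegative pairs. Each part occurs in two of them, which
doubles `B`. -/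
theorem abs_bilin_le {B : ℝ}
    (h : ∀ x y : ι → ℕ, |∑ i, ∑ j, a i j * x i * y j| ≤
      B * (∑ i, (x i : ℝ) ^ 2 + ∑ i, (y i : ℝ) ^ 2)) (x y : ι → ℝ) :
    |∑ i, ∑ j, a i j * x i * y j| ≤ 2 * B * (∑ i, x i ^ 2 + ∑ i, y i ^ 2) := by
  have hsq : ∀ z : ι → ℝ, ∑ i, z i ^ 2 = ∑ i, (z i)⁺ ^ 2 + ∑ i, (z i)⁻ ^ 2 := fun z => by
    rw [← Finset.sum_add_distrib]
    refine Finset.sum_congr rfl fun i _ => ?_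
    have h1 := posPart_sub_negPart (z i)
    have h2 : (z i)⁺ * (z i)⁻ = 0 := by
      rcases le_total 0 (z i) with hz | hz
      · rw [negPart_eq_zero.2 hz, mul_zero]
      · rw [posPart_eq_zero.2 hz, zero_mul]
    calc z i ^ 2 = ((z i)⁺ - (z i)⁻) ^ 2 := by rw [h1]
      _ = (z i)⁺ ^ 2 + (z i)⁻ ^ 2 - 2 * ((z i)⁺ * (z i)⁻) := by ring
      _ = _ := by rw [h2]; ring
  have hexp : ∑ i, ∑ j, a i j * x i * y j =
      (∑ i, ∑ j, a i j * (x i)⁺ * (y j)⁺ + ∑ i, ∑ j, a i j * (x i)⁻ * (y j)⁻) -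
      (∑ i, ∑ j, a i j * (x i)⁺ * (y j)⁻ + ∑ i, ∑ j, a i j * (x i)⁻ * (y j)⁺) := by
    simp only [← Finset.sum_add_distrib, ← Finset.sum_sub_distrib]
    refine Finset.sum_congr rfl fun i _ => Finset.sum_congr rfl fun j _ => ?_
    conv_lhs => rw [← posPart_sub_negPart (x i), ← posPart_sub_negPart (y j)]
    ring
  have hp := fun (z : ι → ℝ) i => posPart_nonneg (z i)
  have hm := fun (z : ι → ℝ) i => negPart_nonneg (z i)
  have h1 := abs_le.1 (abs_bilin_le_of_nonneg h (hp x) (hp y))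
  have h2 := abs_le.1 (abs_bilin_le_of_nonneg h (hm x) (hm y))
  have h3 := abs_le.1 (abs_bilin_le_of_nonneg h (hp x) (hm y))
  have h4 := abs_le.1 (abs_bilin_le_of_nonneg h (hm x) (hp y))
  rw [hexp, hsq x, hsq y]
  exact abs_le.2 ⟨by linarith, by linarith⟩

theorem exists_nat_two_pow_ge {r m : ℝ} (hr : 0 < r) (hm : 1 ≤ m) (hrm : Real.log r ≤ m) :
    ∃ K : ℕ, r ≤ 2 ^ K ∧ (K : ℝ) ≤ 3 * m := by
  -- The factor 2 works because `2 * log 2 > 1`; rounding up costs at most `1 ≤ m`.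
  refine ⟨⌈2 * m⌉₊, ?_, ?_⟩
  · have h1 := Nat.le_ceil (2 * m)
    rw [← Real.log_le_log_iff hr (by positivity), Real.log_pow]
    have h2 := mul_le_mul_of_nonneg_right h1 (Real.log_pos one_lt_two).le
    have h3 := Real.log_two_gt_d9
    have h4 : m * 1 ≤ m * (2 * Real.log 2) :=
      mul_le_mul_of_nonneg_left (by linarith) (by linarith)
    linarith
  · have := Nat.ceil_lt_add_one (by linarith : 0 ≤ 2 * m)
    linarith

/-- A converse of the expander mixing lemma (Bilu and Linial): small discrepancy on disjoint
sets bounds the bilinear form up to a logarithmic factor. -/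
theorem abs_bilin_le_of_discrepancy [DecidableEq ι] (hsymm : ∀ i j, a i j = a j i)
    (hdiag : ∀ i, a i i = 0) {ε η : ℝ} (hε : 0 < ε) (hη : 0 < η)
    (hrow : ∀ i, ∑ j, |a i j| ≤ η) (h : ∀ S T : Finset ι, Disjoint S T →
      |∑ i ∈ S, ∑ j ∈ T, a i j| ≤ ε * √((S.card : ℝ) * (T.card : ℝ))) (x y : ι → ℝ) :
    |∑ i, ∑ j, a i j * x i * y j| ≤
      80 * (ε * max 1 (Real.log (η / ε))) * (∑ i, x i ^ 2 + ∑ i, y i ^ 2) := by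
  set m := max 1 (Real.log (η / ε)) with hm
  obtain ⟨K, hK, hKm⟩ := exists_nat_two_pow_ge (div_pos hη hε) (le_max_left 1 _)
    (le_max_right 1 (Real.log (η / ε)))
  rw [← hm] at hKm
  have hm1 : 1 ≤ m := le_max_left _ _
  have hηK : η ≤ 4 * ε * 2 ^ K := by
    rw [div_le_iff₀ hε] at hK
    have : 0 < 2 ^ K * ε := by positivity
    linarith
  have hS : ∀ S T : Finset ι, |∑ i ∈ S, ∑ j ∈ T, a i j| ≤ η * S.card := fun S T => by
    refine (Finset.abs_sum_le_sum_abs _ _).trans ?_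
    refine (Finset.sum_le_card_nsmul _ _ η fun i _ => ?_).trans (by rw [nsmul_eq_mul, mul_comm])
    refine (Finset.abs_sum_le_sum_abs _ _).trans (le_trans ?_ (hrow i))
    exact Finset.sum_le_sum_of_subset_of_nonneg (Finset.subset_univ _) fun _ _ _ => abs_nonneg _
  have hT : ∀ S T : Finset ι, |∑ i ∈ S, ∑ j ∈ T, a i j| ≤ η * T.card := fun S T => by
    rw [Finset.sum_comm]
    simpa only [hsymm] using hS T S
  -- With `c = 4 * ε`, the constant `c * (2 * (K + 2))` is at most `40 * ε * m`, since `K + 2 ≤ 3 *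
  -- m + 2 ≤ 5 * m`.
  have hnat : ∀ x y : ι → ℕ, |∑ i, ∑ j, a i j * x i * y j| ≤
      40 * (ε * m) * (∑ i, (x i : ℝ) ^ 2 + ∑ i, (y i : ℝ) ^ 2) := fun x y => by
    refine (abs_bilin_natCast_le (by positivity) hηK
      (abs_sum_sum_le_four_mul hsymm hdiag hε.le h) hS hT x y).trans ?_
    refine mul_le_mul_of_nonneg_right ?_ (by positivity)
    have : ε * (K + 2) ≤ ε * (5 * m) := mul_le_mul_of_nonneg_left (by linarith) hε.le
    linarith
  refine (abs_bilin_le hnat x y).trans (le_of_eq ?_)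
  ring

end Bilinear

/-! ### Operator norm of the difference of Laplacians -/

section LaplacianNorm

open scoped RealInnerProductSpace

variable {n : ℕ}

theorem opNorm_le_of_abs_bilin_le {A : Matrix (Fin n) (Fin n) ℝ} {B : ℝ} (hB : 0 ≤ B)
    (h : ∀ x y : Fin n → ℝ, |∑ i, ∑ j, A i j * x i * y j| ≤ B * (∑ i, x i ^ 2 + ∑ i, y i ^ 2)) :
    opNorm A ≤ 2 * B := by
  -- Testing on unit vectors makes the two sums of squares add up to 2, the factor in the
  -- conclusion.
  refine ContinuousLinearMap.opNorm_le_of_re_inner_le (by positivity) fun x y hx hy => ?_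
  have h1 : ⟪Matrix.toEuclideanCLM (n := Fin n) (𝕜 := ℝ) A x, y⟫ =
      ∑ i, ∑ j, A i j * y i * x j := by
    rw [real_inner_comm, Matrix.inner_toEuclideanCLM]
    simp only [dotProduct, Matrix.mulVec, Finset.mul_sum]
    exact Finset.sum_congr rfl fun i _ => Finset.sum_congr rfl fun j _ => by ring
  have h2 : ∀ z : EuclideanSpace ℝ (Fin n), ‖z‖ = 1 → ∑ i, z i ^ 2 = 1 := fun z hz => by
    rw [← EuclideanSpace.real_norm_sq_eq, hz, one_pow]
  have h3 := h y x
  rw [h2 x hx, h2 y hy] at h3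
  rw [RCLike.re_to_real, h1]
  linarith [(abs_le.1 h3).2]

theorem opNorm_diagonal_le {d : Fin n → ℝ} {γ : ℝ} (hγ : 0 ≤ γ) (h : ∀ i, |d i| ≤ γ) :
    opNorm (Matrix.diagonal d) ≤ γ := by
  refine ContinuousLinearMap.opNorm_le_bound _ hγ fun x => ?_
  refine le_of_sq_le_sq ?_ (by positivity)
  rw [mul_pow, EuclideanSpace.real_norm_sq_eq, EuclideanSpace.real_norm_sq_eq, Finset.mul_sum]
  refine Finset.sum_le_sum fun i _ => ?_
  rw [Matrix.ofLp_toEuclideanCLM, Matrix.mulVec_diagonal, mul_pow]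
  exact mul_le_mul_of_nonneg_right (sq_le_sq' (by linarith [(abs_le.1 (h i)).1])
    (abs_le.1 (h i)).2) (sq_nonneg _)

variable {G₁ G₂ : WGraph n} {η ε : ℝ}

theorem opNorm_weights_sub_le (hη : 0 < η) (hε : 0 < ε)
    (hrow : ∀ i, ∑ j ∈ Finset.univ.erase i, |G₁.w i j - G₂.w i j| ≤ η)
    (hcut : ∀ S T : Finset (Fin n), Disjoint S T →
      |G₁.cut S T - G₂.cut S T| ≤ ε * √((S.card : ℝ) * (T.card : ℝ))) :
    opNorm (Matrix.of fun i j => G₁.w i j - G₂.w i j) ≤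
      160 * (ε * max 1 (Real.log (η / ε))) := by
  have h := opNorm_le_of_abs_bilin_le (A := Matrix.of fun i j => G₁.w i j - G₂.w i j)
    (B := 80 * (ε * max 1 (Real.log (η / ε)))) (by positivity)
    (abs_bilin_le_of_discrepancy (a := fun i j => G₁.w i j - G₂.w i j)
      (fun i j => by rw [G₁.symm, G₂.symm]) (fun i => by rw [G₁.loopless, G₂.loopless, sub_zero])
      hε hη (fun i => ?_) (fun S T hST => ?_))
  · linarith
  · rw [← Finset.add_sum_erase _ _ (Finset.mem_univ i), G₁.loopless, G₂.loopless, sub_zero,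
      abs_zero, zero_add]
    exact hrow i
  · simpa only [WGraph.cut, ← Finset.sum_sub_distrib] using hcut S T hST

/-- Triangle inequality for the diagonal and off-diagonal parts. Allowing `γ = 0` covers equal
degrees. -/
theorem opNorm_lap_sub_le {γ : ℝ} (hγ : 0 ≤ γ) (hη : 0 < η) (hε : 0 < ε)
    (hrow : ∀ i, ∑ j ∈ Finset.univ.erase i, |G₁.w i j - G₂.w i j| ≤ η)
    (hdeg : ∀ i, |G₁.deg i - G₂.deg i| ≤ γ)
    (hcut : ∀ S T : Finset (Fin n), Disjoint S T →
      |G₁.cut S T - G₂.cut S T| ≤ ε * √((S.card : ℝ) * (T.card : ℝ))) :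
    opNorm (G₁.lap - G₂.lap) ≤ 160 * (ε * max 1 (Real.log (η / ε))) + γ := by
  have hsub : G₁.lap - G₂.lap = Matrix.diagonal (fun i => G₁.deg i - G₂.deg i) -
      Matrix.of fun i j => G₁.w i j - G₂.w i j := by
    ext i j
    by_cases hij : i = j
    · subst hij
      simp only [WGraph.lap, Matrix.sub_apply, Matrix.diagonal_apply_eq, Matrix.of_apply]
      ring
    · simp only [WGraph.lap, Matrix.sub_apply, Matrix.diagonal_apply_ne _ hij, Matrix.of_apply]
      ring
  have htri : opNorm (G₁.lap - G₂.lap) ≤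
      opNorm (Matrix.diagonal fun i => G₁.deg i - G₂.deg i) +
        opNorm (Matrix.of fun i j => G₁.w i j - G₂.w i j) := by
    rw [hsub, opNorm, map_sub]
    exact norm_sub_le _ _
  linarith [opNorm_diagonal_le hγ hdeg, opNorm_weights_sub_le hη hε hrow hcut]

end LaplacianNorm

end MixedGraph

/-! ### The main theorem -/

theorem mainTheorem6 :
    ∃ C : ℝ, 0 < C ∧
      ∀ (n : ℕ) [NeZero n] (G₁ G₂ : MixedGraph.WGraph n) (η γ ε : ℝ),
        0 < η → 0 < γ → 0 < ε →
        (∀ i, ∑ j ∈ Finset.univ.erase i, |G₁.w i j - G₂.w i j| ≤ η) →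
        (∀ i, |G₁.deg i - G₂.deg i| ≤ γ) →
        (∀ S T : Finset (Fin n), Disjoint S T →
          |G₁.cut S T - G₂.cut S T| ≤ ε * √((S.card : ℝ) * (T.card : ℝ))) →
        MixedGraph.opNorm (G₁.lap - G₂.lap) ≤ C * (ε * max 1 (Real.log (η / ε)) + γ) ∧
        ((∀ i, G₁.deg i = G₂.deg i) →
          MixedGraph.opNorm (G₁.lap - G₂.lap) ≤ C * (ε * max 1 (Real.log (η / ε)))) ∧
        ∀ Δ : ℝ, MixedGraph.opNorm (G₁.lap - G₂.lap) ≤ Δ →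
          MixedGraph.maxOver (fun i => (MixedGraph.eig G₁.lap_isHermitian i - 2 * Δ) /
              (1 + MixedGraph.eig G₁.lap_isHermitian i + Δ) ^ 2) ≤
            MixedGraph.mixedTop G₁ G₂ ∧
          MixedGraph.mixedTop G₁ G₂ ≤
            MixedGraph.maxOver (fun i => (MixedGraph.eig G₁.lap_isHermitian i + 2 * Δ) /
              (1 + max (MixedGraph.eig G₁.lap_isHermitian i - Δ) 0) ^ 2) ∧
          (Δ < 1 → MixedGraph.mixedTop G₁ G₂ ≤
            MixedGraph.maxOver (fun i => (MixedGraph.eig G₁.lap_isHermitian i + 2 * Δ) /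
              (1 + MixedGraph.eig G₁.lap_isHermitian i - Δ) ^ 2)) := by
  refine ⟨160, by norm_num, fun n _ G₁ G₂ η γ ε hη hγ hε hrow hdeg hcut => ⟨?_, ?_, ?_⟩⟩
  · have := MixedGraph.opNorm_lap_sub_le hγ.le hη hε hrow hdeg hcut
    linarith
  · intro heq
    have := MixedGraph.opNorm_lap_sub_le le_rfl hη hε hrow
      (fun i => by rw [heq, sub_self, abs_zero]) hcut
    linarith
  · intro Δ hΔ
    have h := fun i => (abs_le.1 (MixedGraph.abs_eig_lap_sub_le hΔ i)).2
    refine ⟨MixedGraph.maxOver_le_mixedTop hΔ, ?_, fun hΔ1 => ?_⟩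
    · refine MixedGraph.mixedTop_le_maxOver hΔ (fun i => by positivity) fun i => ?_
      exact add_le_add_right (max_le (by linarith [h i]) (MixedGraph.eig_lap_nonneg G₂ i)) 1
    -- Here `d i = 1 + λ - Δ`, which is positive because `λ ≥ 0` and `Δ < 1`.
    · exact MixedGraph.mixedTop_le_maxOver hΔ
        (fun i => by linarith [MixedGraph.eig_lap_nonneg G₁ i]) fun i => by linarith [h i]
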